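/- Let $K$ be a field, $L/K$ a cyclic Galois extension of degree $n$, and $\sigma$ a generator of $\mathrm{Gal}(L/K)$. Let $R=L[x;\sigma]$ be the skew polynomial ring, with $xa=\sigma(a)x$ for $a\in L$. Let $F\in K[y]$ be monic and irreducible of degree $s$, put $E_F=K[y]/(F(y))$ and $R_F=R/RF(x^n)$, and regard $R_F$ as an $E_F$-algebra by letting $y$ act as $x^n$. (i) If $K$ is finite and $F\neq y$, then $R_F\cong M_n(E_F)$ as $E_F$-algebras. (ii) Let $K$ be arbitrary. Every $a\in R$ has a greatest common right divisor $\mathrm{gcrd}(a,F(x^n))$ with $F(x^n)$ in $R$ (a common right divisor that every common right divisor divides on the right). If $e:R_F\to M_n(E_F)$ is any isomorphism of $E_F$-algebras, then the rank of $a$ as an element of $M_n(E_F)$, that is, the rank of the matrix $e(a+RF(x^n))$, is $$\mathrm{rank}(a)=n-\frac1s\deg\bigl(\mathrm{gcrd}(a,F(x^n))\bigr)$$ for any choice of the greatest common right divisor. -/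

import Mathlib

noncomputable section

namespace SkewRank

open Polynomial

variable {K L : Type*} [Field K] [Field L] [Algebra K L]

/-- A copy of the field `L` that remembers the automorphism `σ`, so that Mathlib's skew
polynomials over it are `L[x; σ]`. -/
def Twist (_σ : L ≃ₐ[K] L) : Type _ := L

instance (σ : L ≃ₐ[K] L) : Field (Twist σ) := inferInstanceAs (Field L)

instance (σ : L ≃ₐ[K] L) : Algebra K (Twist σ) := inferInstanceAs (Algebra K L)

/-- The natural number `m` acts on `L` as `σ ^ m`. -/
instance (σ : L ≃ₐ[K] L) : MulSemiringAction (Multiplicative ℕ) (Twist σ) where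
  smul m a := (σ ^ m.toAdd : L ≃ₐ[K] L) a
  one_smul _ := rfl
  mul_smul m k a := by
    change (σ ^ (m.toAdd + k.toAdd) : L ≃ₐ[K] L) a = _
    rw [pow_add]
    rfl
  smul_zero m := map_zero (σ ^ m.toAdd : L ≃ₐ[K] L)
  smul_add m := map_add (σ ^ m.toAdd : L ≃ₐ[K] L)
  smul_one m := map_one (σ ^ m.toAdd : L ≃ₐ[K] L)
  smul_mul m := map_mul (σ ^ m.toAdd : L ≃ₐ[K] L)

theorem smul_def (σ : L ≃ₐ[K] L) (m : Multiplicative ℕ) (a : Twist σ) :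
    m • a = (σ ^ m.toAdd : L ≃ₐ[K] L) a := rfl

instance (σ : L ≃ₐ[K] L) : SMulCommClass (Multiplicative ℕ) K (Twist σ) where
  smul_comm m c a := map_smul (σ ^ m.toAdd : L ≃ₐ[K] L) c a

/-- The skew polynomial ring `R = L[x; σ]`, in which `x * a = σ a * x` for `a` in `L`. -/
abbrev SkewPoly (σ : L ≃ₐ[K] L) : Type _ := SkewPolynomial (Twist σ)

/-- The degree of a skew polynomial (`0` for the zero polynomial). -/
def natDegree {σ : L ≃ₐ[K] L} (p : SkewPoly σ) : ℕ := p.support.sup id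

/-- `g` is a greatest common right divisor of `a` and `b` (such a `g` is unique up to
multiplication on the left by a nonzero constant, so its degree is determined). -/
def IsGCRD {σ : L ≃ₐ[K] L} (g a b : SkewPoly σ) : Prop :=
  (∃ c, a = c * g) ∧ (∃ d, b = d * g) ∧
    ∀ h : SkewPoly σ, (∃ c, a = c * h) → (∃ d, b = d * h) → ∃ e, g = e * h

/-- The skew polynomial `F(x^n)`, where `n` is the order of `σ`. -/
def central (σ : L ≃ₐ[K] L) (F : K[X]) : SkewPoly σ :=
  aeval ((SkewPolynomial.X : SkewPoly σ) ^ orderOf σ) F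

theorem X_pow_comm (σ : L ≃ₐ[K] L) (p : SkewPoly σ) :
    Commute ((SkewPolynomial.X : SkewPoly σ) ^ orderOf σ) p := by
  have h : ∀ b : Twist σ, (SkewPolynomial.φ^[orderOf σ]) b = b := fun b => by
    rw [SkewPolynomial.φ_iterate_apply, smul_def, toAdd_ofAdd, pow_orderOf_eq_one]
    rfl
  rw [Commute, SemiconjBy, SkewPolynomial.X_pow_mul]
  simp only [h, SkewPolynomial.sum_monomial]

theorem central_comm (σ : L ≃ₐ[K] L) (F : K[X]) (p : SkewPoly σ) :
    Commute (central σ F) p := by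
  unfold central
  induction F using Polynomial.induction_on' with
  | add f g hf hg => rw [map_add]; exact hf.add_left hg
  | monomial m c =>
    rw [aeval_monomial]
    exact Commute.mul_left (Algebra.commutes c p) ((X_pow_comm σ p).pow_left m)

/-- The left ideal `R F(x^n)` is two-sided. -/
instance (σ : L ≃ₐ[K] L) (F : K[X]) :
    (Ideal.span {central σ F} : Ideal (SkewPoly σ)).IsTwoSided where
  mul_mem_of_left {a} b ha := by
    obtain ⟨c, rfl⟩ := Ideal.mem_span_singleton'.1 ha
    rw [mul_assoc, (central_comm σ F b).eq, ← mul_assoc]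
    exact Ideal.mul_mem_left _ _ (Ideal.mem_span_singleton_self _)

/-- The quotient ring `R_F = R / R F(x^n)`. -/
def RF (σ : L ≃ₐ[K] L) (F : K[X]) : Type _ :=
  SkewPoly σ ⧸ (Ideal.span {central σ F} : Ideal (SkewPoly σ))

instance (σ : L ≃ₐ[K] L) (F : K[X]) : Ring (RF σ F) :=
  inferInstanceAs (Ring (SkewPoly σ ⧸ (Ideal.span {central σ F} : Ideal (SkewPoly σ))))

/-- The residue map `R → R_F`. -/
def RF.mk (σ : L ≃ₐ[K] L) (F : K[X]) : SkewPoly σ →+* RF σ F :=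
  Ideal.Quotient.mk (Ideal.span {central σ F} : Ideal (SkewPoly σ))

/-- The map `E_F = K[y]/(F) → R_F` that sends the class of `G(y)` to the class of `G(x^n)`. -/
def centreMap (σ : L ≃ₐ[K] L) (F : K[X]) : AdjoinRoot F →+* RF σ F :=
  Ideal.Quotient.lift (Ideal.span {F})
    ((RF.mk σ F).comp
      (aeval ((SkewPolynomial.X : SkewPoly σ) ^ orderOf σ) : K[X] →ₐ[K] SkewPoly σ).toRingHom)
    (fun G hG => by
      obtain ⟨H, rfl⟩ := Ideal.mem_span_singleton'.1 hG
      have h : RF.mk σ F (central σ F) = 0 :=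
        Ideal.Quotient.eq_zero_iff_mem.2 (Ideal.mem_span_singleton_self _)
      change RF.mk σ F (aeval _ (H * F)) = 0
      rw [map_mul, map_mul]
      change _ * RF.mk σ F (central σ F) = 0
      rw [h, mul_zero])

/-- `R_F` is an algebra over `E_F = K[y]/(F)`, with `y` acting as `x^n`. -/
instance (σ : L ≃ₐ[K] L) (F : K[X]) : Algebra (AdjoinRoot F) (RF σ F) :=
  (centreMap σ F).toAlgebra' (fun c r => by
    obtain ⟨G, rfl⟩ := Ideal.Quotient.mk_surjective c
    obtain ⟨p, rfl⟩ := Ideal.Quotient.mk_surjective r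
    change RF.mk σ F (central σ G) * RF.mk σ F p = RF.mk σ F p * RF.mk σ F (central σ G)
    rw [← map_mul, (central_comm σ G p).eq, map_mul])

end SkewRank

end

/-! Right division with remainder makes every left ideal of R principal and gives R/Rg dimension deg
g over L when g is nonzero. (i) If F ≠ y, the image ξ of x in R_F is a unit, and R_F is a sum of
pieces t ξ^i with i < n and t in E_F·L, a quotient of L ⊗ E_F. Twisted commutators with elements of
L isolate a single piece, and the trace of L/K moves its coefficient into E_F. Hence R_F is simple
with centre E_F (`isSimpleRing`, `exists_algebraMap_eq`). For finite K, Wedderburn's theorems give a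
matrix algebra, of size n because the dimension is n². (ii) The kernel of R → R_F/R_F a is Ra +
RF(x^n) = Rg, so the left ideal R_F a has L-dimension ns − deg g (`finrank_range_mulRight_twist`).
In M_n(E_F) a left ideal generated by B has dimension n·rank B (`finrank_range_mulRight`). Comparing
the two dimensions over K gives the formula. -/

noncomputable section
namespace SkewRank

/-! ### Division, left ideals and quotients in skew polynomial rings -/

section SkewPolynomial

open SkewPolynomial

variable {R : Type*} [Field R]

/-- The coefficient of `X ^ k`, as a linear form. -/
def lcoeff (k : ℕ) : SkewPolynomial R →ₗ[R] R where
  toFun p := p.coeff k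
  map_add' p q := by simp [SkewPolynomial.coeff]
  map_smul' a p := by simp [SkewPolynomial.coeff]

theorem coeff_finsetSum {ι : Type*} (s : Finset ι) (f : ι → SkewPolynomial R) (k : ℕ) :
    (∑ i ∈ s, f i).coeff k = ∑ i ∈ s, (f i).coeff k :=
  map_sum (lcoeff k) f s

theorem coeff_eq_zero_of_sup_lt {p : SkewPolynomial R} {k : ℕ} (h : p.support.sup id < k) :
    p.coeff k = 0 := by
  by_contra hne
  exact absurd (Finset.le_sup (f := id) (mem_support_iff.2 hne)) (not_le.2 h)

theorem coeff_sup_ne_zero {p : SkewPolynomial R} (h : p ≠ 0) :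
    p.coeff (p.support.sup id) ≠ 0 := by
  have hne : p.support.Nonempty := by
    rwa [Finset.nonempty_iff_ne_empty, Ne, support_eq_empty]
  obtain ⟨i, hi, he⟩ := Finset.exists_mem_eq_sup p.support hne id
  rw [he]
  exact mem_support_iff.1 hi

theorem sup_support_eq {p : SkewPolynomial R} {d : ℕ} (h₀ : p.coeff d ≠ 0)
    (h : ∀ k, d < k → p.coeff k = 0) : p.support.sup id = d := by
  apply le_antisymm
  · refine Finset.sup_le fun k hk => ?_
    by_contra hlt
    exact mem_support_iff.1 hk (h k (not_le.1 hlt))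
  · exact Finset.le_sup (f := id) (mem_support_iff.2 h₀)

variable [MulSemiringAction (Multiplicative ℕ) R]

theorem coeff_mul_eq_sum (p q : SkewPolynomial R) (k : ℕ) :
    (p * q).coeff k = ∑ i ∈ p.support, ∑ j ∈ q.support,
      if i + j = k then p.coeff i * φ^[i] (q.coeff j) else 0 := by
  rw [SkewPolynomial.mul_def, SkewPolynomial.sum_def, coeff_finsetSum]
  refine Finset.sum_congr rfl fun i _ => ?_
  rw [SkewPolynomial.sum_def, coeff_finsetSum]
  exact Finset.sum_congr rfl fun j _ => coeff_monomial

theorem phi_iterate_eq_zero {m : ℕ} {a : R} : (φ^[m] a) = 0 ↔ a = 0 := by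
  rw [φ_iterate_apply]
  exact map_eq_zero (MulSemiringAction.toRingHom (Multiplicative ℕ) R (Multiplicative.ofAdd m))

/-- The top coefficient of a product is the skew product of the top coefficients. -/
theorem coeff_mul_top {p q : SkewPolynomial R} {m d : ℕ} (hp : ∀ k, m < k → p.coeff k = 0)
    (hq : ∀ k, d < k → q.coeff k = 0) :
    (p * q).coeff (m + d) = p.coeff m * φ^[m] (q.coeff d) := by
  rw [coeff_mul_eq_sum]
  have key : ∀ i j, i + j = m + d → (i, j) ≠ (m, d) → p.coeff i * φ^[i] (q.coeff j) = 0 := by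
    intro i j hij hne
    rcases lt_trichotomy i m with h | h | h
    · rw [hq j (by omega), phi_iterate_eq_zero.2 rfl, mul_zero]
    · exact absurd (Prod.ext h (show j = d by omega)) hne
    · rw [hp i h, zero_mul]
  rw [Finset.sum_eq_single m, Finset.sum_eq_single d]
  · rw [if_pos rfl]
  · intro j _ hj
    split_ifs with h
    · omega
    · rfl
  · intro h
    rw [if_pos rfl, notMem_support_iff.1 h, phi_iterate_eq_zero.2 rfl, mul_zero]
  · intro i _ hi
    refine Finset.sum_eq_zero fun j _ => ?_
    split_ifs with h
    · exact key i j h fun h' => hi (Prod.mk.inj h').1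
    · rfl
  · intro h
    refine Finset.sum_eq_zero fun j _ => ?_
    rw [notMem_support_iff.1 h]
    simp

theorem coeff_mul_of_lt {p q : SkewPolynomial R} {m d k : ℕ} (hp : ∀ k, m < k → p.coeff k = 0)
    (hq : ∀ k, d < k → q.coeff k = 0) (hk : m + d < k) : (p * q).coeff k = 0 := by
  rw [coeff_mul_eq_sum]
  refine Finset.sum_eq_zero fun i _ => Finset.sum_eq_zero fun j _ => ?_
  split_ifs with h
  · by_cases hi : m < i
    · rw [hp i hi, zero_mul]
    · rw [hq j (by omega), phi_iterate_eq_zero.2 rfl, mul_zero]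
  · rfl

/-- Right division with remainder. -/
theorem exists_eq_mul_add {g : SkewPolynomial R} (hg : g ≠ 0) (p : SkewPolynomial R) :
    ∃ q r, p = q * g + r ∧ ∀ k, g.support.sup id ≤ k → r.coeff k = 0 := by
  set d := g.support.sup id with hd
  -- Induction on a strict bound N for the degree, so that p = 0 needs no special treatment.
  suffices H : ∀ N, ∀ p : SkewPolynomial R, (∀ k, N ≤ k → p.coeff k = 0) →
      ∃ q r, p = q * g + r ∧ ∀ k, d ≤ k → r.coeff k = 0 from
    H (p.support.sup id + 1) p fun k hk => coeff_eq_zero_of_sup_lt hk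
  intro N
  induction N with
  | zero => exact fun p hp => ⟨0, p, by simp, fun k _ => hp k (Nat.zero_le k)⟩
  | succ N ih =>
    intro p hp
    rcases lt_or_ge N d with hN | hN
    · exact ⟨0, p, by simp, fun k hk => hp k (by omega)⟩
    obtain ⟨m, rfl⟩ := Nat.exists_eq_add_of_le' hN
    have hlc : (φ^[m] (g.coeff d)) ≠ 0 := fun h =>
      coeff_sup_ne_zero hg (phi_iterate_eq_zero.1 h)
    -- Chosen so that a x^m g has the same coefficient at m + d as p, since x^m twists the leading
    -- coefficient of g.
    set a := p.coeff (m + d) * (φ^[m] (g.coeff d))⁻¹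
    have hmon : ∀ k, m < k → (monomial m a).coeff k = 0 := fun k hk => by
      rw [coeff_monomial, if_neg hk.ne]
    have hg' : ∀ k, d < k → g.coeff k = 0 := fun k hk => coeff_eq_zero_of_sup_lt hk
    obtain ⟨q, r, h, hr⟩ := ih (p - monomial m a * g) fun k hk => by
      change lcoeff k _ = 0
      rw [map_sub]
      change p.coeff k - (monomial m a * g).coeff k = 0
      rcases hk.eq_or_lt with rfl | hk
      · rw [coeff_mul_top hmon hg', coeff_monomial, if_pos rfl, inv_mul_cancel_right₀ hlc,
          sub_self]
      · rw [hp k hk, coeff_mul_of_lt hmon hg' hk, sub_zero]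
    exact ⟨q + monomial m a, r, by rw [add_mul, add_right_comm, ← h, sub_add_cancel], hr⟩

/-- A nonzero left multiple of `g` has degree at least that of `g`. -/
theorem eq_zero_of_mul_coeff_eq_zero {c g : SkewPolynomial R} (hg : g ≠ 0)
    (h : ∀ k, g.support.sup id ≤ k → (c * g).coeff k = 0) : c = 0 := by
  by_contra hc
  have := h (c.support.sup id + g.support.sup id) (by omega)
  rw [coeff_mul_top (fun k hk => coeff_eq_zero_of_sup_lt hk)
    (fun k hk => coeff_eq_zero_of_sup_lt hk)] at this
  rcases mul_eq_zero.1 this with h | h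
  · exact coeff_sup_ne_zero hc h
  · exact coeff_sup_ne_zero hg (phi_iterate_eq_zero.1 h)

/-- Every left ideal of a skew polynomial ring over a field is principal. -/
theorem exists_eq_span_singleton (I : Ideal (SkewPolynomial R)) : ∃ g, I = Ideal.span {g} := by
  classical
  by_cases hI : I = ⊥
  · exact ⟨0, by rw [hI, Ideal.span_singleton_eq_bot.2 rfl]⟩
  obtain ⟨b, hb, hb0⟩ := Submodule.exists_mem_ne_zero_of_ne_bot hI
  have hex : ∃ d, ∃ g ∈ I, g ≠ 0 ∧ g.support.sup id = d := ⟨_, b, hb, hb0, rfl⟩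
  obtain ⟨g, hgI, hg0, hgd⟩ := Nat.find_spec hex
  refine ⟨g, le_antisymm (fun p hp => ?_) ((Ideal.span_singleton_le_iff_mem I).2 hgI)⟩
  obtain ⟨q, r, h, hr⟩ := exists_eq_mul_add hg0 p
  have hrI : r ∈ I := by
    rw [← sub_eq_iff_eq_add'.2 h]
    exact I.sub_mem hp (I.mul_mem_left q hgI)
  have hr0 : r = 0 := by
    by_contra hne
    refine Nat.find_min hex (m := r.support.sup id) ?_ ⟨r, hrI, hne, rfl⟩
    rw [← hgd]
    by_contra hlt
    exact coeff_sup_ne_zero hne (hr _ (not_lt.1 hlt))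
  rw [h, hr0, add_zero]
  exact Ideal.mem_span_singleton'.2 ⟨q, rfl⟩

theorem coeff_sum_smul_X_pow {d : ℕ} (v : Fin d → R) (k : ℕ) :
    (∑ i, v i • (X : SkewPolynomial R) ^ (i : ℕ)).coeff k =
      if h : k < d then v ⟨k, h⟩ else 0 := by
  have hk : ∀ i : Fin d, (v i • (X : SkewPolynomial R) ^ (i : ℕ)).coeff k =
      if (i : ℕ) = k then v i else 0 := fun i => by
    rw [← monomial_one_right_eq_X_pow, smul_monomial, smul_eq_mul, mul_one, coeff_monomial]
  rw [coeff_finsetSum, Finset.sum_congr rfl fun i _ => hk i]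
  split_ifs with h
  · rw [Finset.sum_eq_single ⟨k, h⟩]
    · simp
    · exact fun j _ hj => if_neg fun h' => hj (Fin.ext h')
    · simp
  · exact Finset.sum_eq_zero fun j _ => if_neg fun h' : (j : ℕ) = k => h (h' ▸ j.2)

/-- The powers `1, X, …, X ^ (d - 1)` form a basis modulo a skew polynomial of degree `d`. -/
def quotientEquiv {g : SkewPolynomial R} (hg : g ≠ 0) :
    (Fin (g.support.sup id) → R) ≃ₗ[R] SkewPolynomial R ⧸ Ideal.span {g} :=
  LinearEquiv.ofBijective
    (((Ideal.span {g}).mkQ.restrictScalars R).comp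
      (Fintype.linearCombination R fun i : Fin (g.support.sup id) =>
        (X : SkewPolynomial R) ^ (i : ℕ))) <| by
    constructor
    · rw [← LinearMap.ker_eq_bot, LinearMap.ker_eq_bot']
      intro v hv
      have hv' : (∑ i, v i • (X : SkewPolynomial R) ^ (i : ℕ)) ∈ Ideal.span {g} :=
        (Submodule.Quotient.mk_eq_zero _).1 hv
      obtain ⟨c, hc⟩ := Ideal.mem_span_singleton'.1 hv'
      have hc0 : c = 0 := eq_zero_of_mul_coeff_eq_zero hg fun k hk => by
        rw [hc, coeff_sum_smul_X_pow, dif_neg (not_lt.2 hk)]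
      ext i
      have := coeff_sum_smul_X_pow v i
      rw [← hc, hc0, zero_mul, dif_pos i.2] at this
      exact this.symm
    · intro y
      obtain ⟨p, rfl⟩ := Submodule.Quotient.mk_surjective _ y
      obtain ⟨q, r, h, hr⟩ := exists_eq_mul_add hg p
      refine ⟨fun i => r.coeff i, (Submodule.Quotient.eq _).2 ?_⟩
      have : Fintype.linearCombination R (fun i : Fin (g.support.sup id) =>
          (X : SkewPolynomial R) ^ (i : ℕ)) (fun i => r.coeff i) = r := by
        refine SkewPolynomial.ext fun k => ?_
        refine (coeff_sum_smul_X_pow _ k).trans ?_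
        split_ifs with hk
        · rfl
        · exact (hr k (not_lt.1 hk)).symm
      rw [this, h]
      exact Ideal.mem_span_singleton'.2 ⟨-q, by rw [neg_mul]; abel⟩

theorem finrank_quotient_span {g : SkewPolynomial R} (hg : g ≠ 0) :
    Module.finrank R (SkewPolynomial R ⧸ Ideal.span {g}) = g.support.sup id := by
  rw [← (quotientEquiv hg).finrank_eq, Module.finrank_fin_fun]

theorem finite_quotient_span {g : SkewPolynomial R} (hg : g ≠ 0) :
    Module.Finite R (SkewPolynomial R ⧸ Ideal.span {g}) :=
  Module.Finite.equiv (quotientEquiv hg)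

end SkewPolynomial

/-! ### Cyclic algebras: simplicity and centre -/

/-- `A` is an algebra over `E` generated by a copy `c` of `L` and a unit `ξ` that induces `σ`
on `L`: a cyclic algebra. -/
structure IsCyclicAlgebra {K L E A : Type*} [Field K] [Field L] [Algebra K L] [Field E]
    [Algebra K E] [Ring A] [Algebra E A] (σ : L ≃ₐ[K] L) (c : L →+* A) (ξ : Aˣ) : Prop where
  map_algebraMap : ∀ k, c (algebraMap K L k) = algebraMap E A (algebraMap K E k)
  mul_map : ∀ a, ξ * c a = c (σ a) * ξ
  exists_sum : ∀ z : A, ∃ t : ℕ → A, (∀ i, t i ∈ Submodule.span E (Set.range c)) ∧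
    z = ∑ i ∈ Finset.range (orderOf σ), t i * ξ ^ i

namespace IsCyclicAlgebra

variable {K L E A : Type*} [Field K] [Field L] [Algebra K L] [Field E]
    [Algebra K E] [Ring A] [Algebra E A] {σ : L ≃ₐ[K] L} {c : L →+* A} {ξ : Aˣ}

theorem pow_mul_map (h : IsCyclicAlgebra (E := E) σ c ξ) (i : ℕ) (a : L) :
    (ξ : A) ^ i * c a = c ((σ ^ i) a) * (ξ : A) ^ i := by
  induction i generalizing a with
  | zero => simp
  | succ i ih => rw [pow_succ, mul_assoc, h.mul_map, ← mul_assoc, ih, mul_assoc, pow_succ]; rfl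

theorem commute_map (a : L) {t : A} (ht : t ∈ Submodule.span E (Set.range c)) :
    t * c a = c a * t := by
  induction ht using Submodule.span_induction with
  | mem x hx => obtain ⟨b, rfl⟩ := hx; rw [← map_mul, mul_comm, map_mul]
  | zero => simp
  | add x y _ _ hx hy => rw [add_mul, mul_add, hx, hy]
  | smul r x _ hx => rw [smul_mul_assoc, mul_smul_comm, hx]

/-- Moving c b to the left past ξ^i turns b into σ^i b, so the commutator twisted by σ^m scales
component i by σ^i b − σ^m b and kills component m. -/
theorem sum_twisted_commutator (h : IsCyclicAlgebra (E := E) σ c ξ) {t : ℕ → A}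
    (ht : ∀ i, t i ∈ Submodule.span E (Set.range c)) (s : Finset ℕ) (d : ℕ → L) (m : ℕ) (b : L) :
    (∑ i ∈ s, c (d i) * (t i * (ξ : A) ^ i)) * c b -
      c ((σ ^ m) b) * ∑ i ∈ s, c (d i) * (t i * (ξ : A) ^ i) =
    ∑ i ∈ s, c (((σ ^ i) b - (σ ^ m) b) * d i) * (t i * (ξ : A) ^ i) := by
  rw [Finset.sum_mul, Finset.mul_sum, ← Finset.sum_sub_distrib]
  refine Finset.sum_congr rfl fun i _ => ?_
  rw [mul_assoc (c _) (t i * _), mul_assoc (t i), h.pow_mul_map, ← mul_assoc (t i),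
    commute_map _ (ht i), map_mul, map_sub, sub_mul, sub_mul]
  congr 1
  · rw [← map_mul, mul_comm ((σ ^ i) b), map_mul]; simp only [mul_assoc]
  · rw [mul_assoc]

theorem sum_mem (h : IsCyclicAlgebra (E := E) σ c ξ) (I : Ideal A) [I.IsTwoSided] {t : ℕ → A}
    (ht : ∀ i, t i ∈ Submodule.span E (Set.range c)) (s : Finset ℕ) (a : ℕ → L) (n : ℕ)
    (hz : ∑ i ∈ Finset.range n, t i * (ξ : A) ^ i ∈ I) :
    ∑ i ∈ Finset.range n, c (∏ m ∈ s, ((σ ^ i) (a m) - (σ ^ m) (a m))) * (t i * (ξ : A) ^ i) ∈ I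
    := by
  classical
  induction s using Finset.induction_on with
  | empty => simpa using hz
  | insert m s hm ih =>
    simp only [Finset.prod_insert hm]
    rw [← h.sum_twisted_commutator ht]
    exact I.sub_mem (Ideal.IsTwoSided.mul_mem_of_left _ ih) (I.mul_mem_left _ ih)

theorem exists_separating {i : ℕ} (hi : i < orderOf σ) :
    ∃ a : ℕ → L, ∀ m ∈ (Finset.range (orderOf σ)).erase i, (σ ^ i) (a m) - (σ ^ m) (a m) ≠ 0 := by
  have : ∀ m, ∃ b : L, m ∈ (Finset.range (orderOf σ)).erase i →
      (σ ^ i) b - (σ ^ m) b ≠ 0 := fun m => by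
    by_contra! hcon
    -- The value 0 is arbitrary: it only extracts the membership of m, which does not depend on b.
    obtain ⟨hm, -⟩ := hcon 0
    refine (Finset.mem_erase.1 hm).1 (pow_injOn_Iio_orderOf
      (Finset.mem_range.1 (Finset.mem_erase.1 hm).2) hi ?_)
    exact AlgEquiv.ext fun b => (sub_eq_zero.1 (hcon b).2).symm
  choose a ha using this
  exact ⟨a, ha⟩

theorem prod_eq_zero {i j : ℕ} (a : ℕ → L) (hj : j ∈ Finset.range (orderOf σ)) (hij : j ≠ i) :
    ∏ m ∈ (Finset.range (orderOf σ)).erase i, ((σ ^ j) (a m) - (σ ^ m) (a m)) = 0 :=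
  Finset.prod_eq_zero (Finset.mem_erase.2 ⟨hij, hj⟩) (sub_self _)

/-- Commutators for all m ≠ i leave only component i, scaled by a nonzero element of L; that scalar
and the unit ξ^i are then cancelled. -/
theorem component_mem (h : IsCyclicAlgebra (E := E) σ c ξ) (I : Ideal A) [I.IsTwoSided]
    {t : ℕ → A} (ht : ∀ i, t i ∈ Submodule.span E (Set.range c))
    (hz : ∑ i ∈ Finset.range (orderOf σ), t i * (ξ : A) ^ i ∈ I) {i : ℕ} (hi : i < orderOf σ) :
    t i ∈ I := by
  obtain ⟨a, ha⟩ := exists_separating hi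
  have := h.sum_mem I ht ((Finset.range (orderOf σ)).erase i) a _ hz
  rw [Finset.sum_eq_single i (fun j hj hji => by rw [prod_eq_zero a hj hji, map_zero, zero_mul])
    (fun hi' => absurd (Finset.mem_range.2 hi) hi')] at this
  have h1 := I.mul_mem_left (c (∏ m ∈ (Finset.range (orderOf σ)).erase i,
    ((σ ^ i) (a m) - (σ ^ m) (a m)))⁻¹) this
  rw [← mul_assoc, ← map_mul, inv_mul_cancel₀ (Finset.prod_ne_zero_iff.2 ha), map_one,
    one_mul] at h1
  have h2 := Ideal.IsTwoSided.mul_mem_of_left (((ξ ^ i)⁻¹ : Aˣ) : A) h1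
  rwa [mul_assoc, ← Units.val_pow_eq_pow_val, Units.mul_inv, mul_one] at h2

/-- A central element has only the component of index `0`. -/
theorem mem_span_of_central (h : IsCyclicAlgebra (E := E) σ c ξ) (hσ : 0 < orderOf σ) {z : A}
    (hz : ∀ y, z * y = y * z) : z ∈ Submodule.span E (Set.range c) := by
  obtain ⟨t, ht, hzt⟩ := h.exists_sum z
  -- On a central z the twisted commutator is left multiplication by b − σ^m b, so z is scaled
  -- exactly as its component of index 0 is.
  have H : ∀ (s : Finset ℕ) (a : ℕ → L),
      c (∏ m ∈ s, (a m - (σ ^ m) (a m))) * z = ∑ i ∈ Finset.range (orderOf σ),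
        c (∏ m ∈ s, ((σ ^ i) (a m) - (σ ^ m) (a m))) * (t i * (ξ : A) ^ i) := by
    classical
    intro s a
    induction s using Finset.induction_on with
    | empty => simpa using hzt
    | insert m s hm ih =>
      have e1 : c (∏ m ∈ insert m s, (a m - (σ ^ m) (a m))) * z =
          (c (∏ m ∈ s, (a m - (σ ^ m) (a m))) * z) * c (a m) -
            c ((σ ^ m) (a m)) * (c (∏ m ∈ s, (a m - (σ ^ m) (a m))) * z) := by
        rw [Finset.prod_insert hm, mul_assoc _ z, hz, ← mul_assoc, ← mul_assoc, ← map_mul,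
          ← map_mul, ← sub_mul, ← map_sub]
        congr 2; ring
      rw [e1, ih, h.sum_twisted_commutator ht]
      simp only [Finset.prod_insert hm]
  obtain ⟨a, ha⟩ := exists_separating hσ
  have := H ((Finset.range (orderOf σ)).erase 0) a
  rw [Finset.sum_eq_single 0 (fun j hj hji => by rw [prod_eq_zero a hj hji, map_zero, zero_mul])
    (fun hi' => absurd (Finset.mem_range.2 hσ) hi')] at this
  simp only [pow_zero, AlgEquiv.one_apply, mul_one] at this ha
  have h1 := congrArg (c (∏ m ∈ (Finset.range (orderOf σ)).erase 0,
    (a m - (σ ^ m) (a m)))⁻¹ * ·) this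
  simp only [← mul_assoc] at h1
  rw [← map_mul, inv_mul_cancel₀ (Finset.prod_ne_zero_iff.2 ha), map_one, one_mul, one_mul] at h1
  exact h1 ▸ ht 0

theorem exists_eq_sum_smul (h : IsCyclicAlgebra (E := E) σ c ξ) {ι : Type*} [Fintype ι]
    (b : Module.Basis ι K L) {t : A} (ht : t ∈ Submodule.span E (Set.range c)) :
    ∃ e : ι → E, t = ∑ i, e i • c (b i) := by
  suffices H : Submodule.span E (Set.range c) ≤
      LinearMap.range (Fintype.linearCombination E fun i => c (b i)) by
    obtain ⟨e, he⟩ := H ht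
    exact ⟨e, he.symm⟩
  refine Submodule.span_le.2 ?_
  rintro _ ⟨x, rfl⟩
  refine ⟨fun i => algebraMap K E (b.repr x i), ?_⟩
  conv_rhs => rw [← b.sum_repr x]
  rw [Fintype.linearCombination_apply, map_sum]
  refine Finset.sum_congr rfl fun i _ => ?_
  rw [Algebra.smul_def (b.repr x i), map_mul, h.map_algebraMap, Algebra.smul_def]

section Trace

variable [FiniteDimensional K L] [IsGalois K L]

theorem _root_.SkewRank.sum_pow_apply (hσ : ∀ τ : L ≃ₐ[K] L, τ ∈ Subgroup.zpowers σ) (x : L) :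
    ∑ j ∈ Finset.range (orderOf σ), (σ ^ j) x = algebraMap K L (Algebra.trace K L x) := by
  classical
  rw [trace_eq_sum_automorphisms]
  refine Finset.sum_nbij (fun j => σ ^ j) (fun _ _ => Finset.mem_univ _) ?_ ?_ fun _ _ => rfl
  · intro i hi j hj hij
    exact pow_injOn_Iio_orderOf (Finset.mem_range.1 hi) (Finset.mem_range.1 hj) hij
  · intro τ _
    have h1 := (isOfFinOrder_of_finite σ).mem_powers_iff_mem_zpowers.2 (hσ τ)
    rw [(isOfFinOrder_of_finite σ).mem_powers_iff_mem_range_orderOf] at h1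
    obtain ⟨j, hj, rfl⟩ := Finset.mem_image.1 h1
    exact ⟨j, hj, rfl⟩

/-- Conjugation by ξ^j is σ^j on L and trivial on E, so summing over j takes the trace. -/
theorem sum_conj (h : IsCyclicAlgebra (E := E) σ c ξ)
    (hσ : ∀ τ : L ≃ₐ[K] L, τ ∈ Subgroup.zpowers σ) {ι : Type*} [Fintype ι]
    (b : ι → L) (e : ι → E) (l : L) :
    ∑ j ∈ Finset.range (orderOf σ),
      (ξ : A) ^ j * (c l * ∑ i, e i • c (b i)) * ((ξ ^ j)⁻¹ : Aˣ) =
    algebraMap E A (∑ i, e i * algebraMap K E (Algebra.trace K L (l * b i))) := by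
  have : ∀ j, (ξ : A) ^ j * (c l * ∑ i, e i • c (b i)) * ((ξ ^ j)⁻¹ : Aˣ) =
      ∑ i, e i • c ((σ ^ j) (l * b i)) := fun j => by
    rw [Finset.mul_sum, Finset.mul_sum, Finset.sum_mul]
    refine Finset.sum_congr rfl fun i _ => ?_
    rw [mul_smul_comm, mul_smul_comm, smul_mul_assoc, ← map_mul, h.pow_mul_map, mul_assoc,
      ← Units.val_pow_eq_pow_val, Units.mul_inv, mul_one]
  simp only [this]
  rw [Finset.sum_comm, map_sum]
  refine Finset.sum_congr rfl fun i _ => ?_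
  rw [← Finset.smul_sum, ← map_sum, sum_pow_apply hσ, h.map_algebraMap, Algebra.smul_def,
    map_mul (algebraMap E A)]

/-- A cyclic algebra is simple. -/
theorem isSimpleRing [Nontrivial A] (h : IsCyclicAlgebra (E := E) σ c ξ)
    (hσ : ∀ τ : L ≃ₐ[K] L, τ ∈ Subgroup.zpowers σ) : IsSimpleRing A := by
  classical
  refine isSimpleRing_iff_isTwoSided_imp.2 ⟨inferInstance, fun I hI => ?_⟩
  refine or_iff_not_imp_left.2 fun hne => ?_
  obtain ⟨z, hz, hz0⟩ := Submodule.exists_mem_ne_zero_of_ne_bot hne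
  obtain ⟨t, ht, rfl⟩ := h.exists_sum z
  obtain ⟨i, hi, hti⟩ := Finset.exists_ne_zero_of_sum_ne_zero hz0
  have hmem := h.component_mem I ht hz (Finset.mem_range.1 hi)
  let b := Module.finBasis K L
  obtain ⟨e, he⟩ := h.exists_eq_sum_smul b (ht i)
  have hex : ∃ k, e k ≠ 0 := by
    by_contra! hcon
    exact hti (by rw [he]; simp [hcon])
  obtain ⟨k, hk⟩ := hex
  have hnd := traceForm_nondegenerate K L
  -- Multiplying by the trace-dual basis vector makes the sum of conjugates equal to the single
  -- coordinate e k, a nonzero scalar lying in the ideal.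
  have hsum := h.sum_conj hσ b e ((Algebra.traceForm K L).dualBasis hnd b k)
  have htr : ∀ i, Algebra.trace K L ((Algebra.traceForm K L).dualBasis hnd b k * b i) =
      if i = k then 1 else 0 :=
    fun i => LinearMap.BilinForm.apply_dualBasis_left hnd b k i
  simp only [htr] at hsum
  have hval : ∑ i, e i * algebraMap K E (if i = k then 1 else 0) = e k := by simp
  rw [hval] at hsum
  have hek : algebraMap E A (e k) ∈ I := by
    rw [← hsum, ← he]
    exact I.sum_mem fun j _ => Ideal.IsTwoSided.mul_mem_of_left _
      (I.mul_mem_left _ (I.mul_mem_left _ hmem))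
  exact Ideal.eq_top_of_isUnit_mem I hek ((IsUnit.mk0 _ hk).map (algebraMap E A))

/-- The centre of a cyclic algebra over `E` is `E`. -/
theorem exists_algebraMap_eq (h : IsCyclicAlgebra (E := E) σ c ξ)
    (hσ : ∀ τ : L ≃ₐ[K] L, τ ∈ Subgroup.zpowers σ) {z : A} (hz : ∀ y, z * y = y * z) :
    ∃ e, algebraMap E A e = z := by
  -- With l of trace 1, the sum of conjugates of c l * z is z itself, because z is central;
  -- `sum_conj` places it in E.
  obtain ⟨l, hl⟩ := Algebra.trace_surjective K L 1
  let b := Module.finBasis K L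
  obtain ⟨e, he⟩ := h.exists_eq_sum_smul b
    (h.mem_span_of_central (isOfFinOrder_of_finite σ).orderOf_pos hz)
  refine ⟨_, (h.sum_conj hσ b e l).symm.trans ?_⟩
  rw [← he]
  have : ∀ j, (ξ : A) ^ j * (c l * z) * ((ξ ^ j)⁻¹ : Aˣ) = c ((σ ^ j) l) * z := fun j => by
    rw [← mul_assoc, h.pow_mul_map, mul_assoc _ _ z, ← hz, ← mul_assoc, mul_assoc _ _ (_ : A),
      ← Units.val_pow_eq_pow_val, Units.mul_inv, mul_one]
  simp only [this]
  rw [← Finset.sum_mul, ← map_sum, sum_pow_apply hσ, hl, map_one, map_one, one_mul]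

end Trace

end IsCyclicAlgebra

/-! ### Matrix algebras: Wedderburn's theorems and the rank -/

/-- A finite simple algebra over `E` whose centre is `E` is a matrix algebra. -/
theorem exists_algEquiv_matrix_of_finite (E A : Type*) [Field E] [Finite E] [Ring A]
    [Algebra E A] [Module.Finite E A] [IsSimpleRing A]
    (hc : ∀ z : A, (∀ y, z * y = y * z) → ∃ e, algebraMap E A e = z) (n : ℕ)
    (hn : Module.finrank E A = n ^ 2) : Nonempty (A ≃ₐ[E] Matrix (Fin n) (Fin n) E) := by
  have : IsArtinianRing A := IsArtinianRing.of_finite E A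
  obtain ⟨m, hm, D, _, _, _, ⟨f⟩⟩ := IsSimpleRing.exists_algEquiv_matrix_divisionRing_finite E A
  have : Finite D := Module.finite_of_finite E
  have hcomm : ∀ x y : D, x * y = y * x := (Finite.isDomain_to_isField D).mul_comm
  have hbij : Function.Bijective (Algebra.ofId E D) := by
    refine ⟨(algebraMap E D).injective, fun d => ?_⟩
    -- As D is commutative, scalar matrices over D are central, so they come from E.
    obtain ⟨e, he⟩ := hc (f.symm (Matrix.scalar (Fin m) d)) fun y => by
      apply f.injective
      rw [map_mul, map_mul, f.apply_symm_apply]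
      exact Matrix.scalar_commute d (hcomm d) (f y)
    refine ⟨e, ?_⟩
    have h1 := congrArg f he
    rw [f.apply_symm_apply, f.commutes] at h1
    have h2 := congrFun (congrFun h1 0) 0
    simpa [Matrix.algebraMap_matrix_apply] using h2
  let g : E ≃ₐ[E] D := AlgEquiv.ofBijective _ hbij
  let f' : A ≃ₐ[E] Matrix (Fin m) (Fin m) E := f.trans g.symm.mapMatrix
  have hd := f'.toLinearEquiv.finrank_eq
  rw [hn, Module.finrank_matrix, Module.finrank_self, Fintype.card_fin, mul_one, ← pow_two] at hd
  obtain rfl : n = m := Nat.pow_left_injective (by norm_num) hd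
  exact ⟨f'⟩

open Polynomial

/-- The rank of the left ideal of `M_n(E)` generated by a matrix. -/
theorem finrank_range_mulRight {E : Type*} [Field E] {n : ℕ} (B : Matrix (Fin n) (Fin n) E) :
    Module.finrank E (LinearMap.range (LinearMap.mulRight E B)) = n * B.rank := by
  let r : (Fin n → E) →ₗ[E] (Fin n → E) := B.vecMulLinear
  have hr : Module.finrank E (LinearMap.range r) = B.rank := by
    rw [← B.rank_transpose, Matrix.rank, Matrix.mulVecLin_transpose]
  -- The rows of M * B are n independent, arbitrary vectors of the row space of B.
  let f : Matrix (Fin n) (Fin n) E →ₗ[E] (Fin n → LinearMap.range r) :=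
    LinearMap.pi fun i => r.rangeRestrict.comp (LinearMap.proj i)
  let g : (Fin n → LinearMap.range r) →ₗ[E] Matrix (Fin n) (Fin n) E :=
    LinearMap.pi fun i => (LinearMap.range r).subtype.comp (LinearMap.proj i)
  have hgf : g ∘ₗ f = LinearMap.mulRight E B := by
    refine LinearMap.ext fun M => ?_
    ext i j
    rfl
  have hf : LinearMap.range f = ⊤ := by
    refine LinearMap.range_eq_top.2 fun v => ?_
    choose w hw using fun i => r.surjective_rangeRestrict (v i)
    exact ⟨Matrix.of w, funext fun i => hw i⟩
  have hg : Function.Injective g := fun v w h =>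
    funext fun i => Subtype.ext (congrFun h i)
  rw [← hgf, LinearMap.range_comp_of_range_eq_top _ hf, LinearMap.finrank_range_of_inj hg,
    Module.finrank_pi_fintype]
  simp [hr]

/-! ### The algebra R_F over L, K and E_F -/

section

variable {K L : Type*} [Field K] [Field L] [Algebra K L] (σ : L ≃ₐ[K] L) (F : K[X])

/-- The inclusion `L → R_F`. -/
def coeffHom : Twist σ →+* RF σ F := (RF.mk σ F).comp SkewPolynomial.CRingHom

/-- `R_F` as a left vector space over `L`. -/
instance moduleTwistRF : Module (Twist σ) (RF σ F) := Module.compHom _ (coeffHom σ F)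

/-- `R_F` as a vector space over `K`. -/
instance moduleBaseRF : Module K (RF σ F) := Module.compHom _ (algebraMap K (AdjoinRoot F))

theorem mk_central (G : K[X]) :
    RF.mk σ F (central σ G) = algebraMap (AdjoinRoot F) (RF σ F) (AdjoinRoot.mk F G) := rfl

theorem coeffHom_algebraMap (k : K) : coeffHom σ F (algebraMap K (Twist σ) k) =
    algebraMap (AdjoinRoot F) (RF σ F) (algebraMap K (AdjoinRoot F) k) := by
  have h : algebraMap K (AdjoinRoot F) k = AdjoinRoot.mk F (C k) := rfl
  rw [h, ← mk_central]
  refine congrArg (RF.mk σ F) ?_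
  rw [central, aeval_C]
  rfl

instance : IsScalarTower K (AdjoinRoot F) (RF σ F) where
  smul_assoc k e r := by
    change (k • e) • r = algebraMap K (AdjoinRoot F) k • e • r
    rw [Algebra.smul_def k e, mul_smul]

instance : IsScalarTower K (Twist σ) (RF σ F) where
  smul_assoc k a r := by
    change coeffHom σ F (k • a) * r = algebraMap K (AdjoinRoot F) k • (coeffHom σ F a * r)
    rw [Algebra.smul_def, map_mul, coeffHom_algebraMap, mul_assoc, Algebra.smul_def]

instance : IsScalarTower (Twist σ) (RF σ F) (RF σ F) where
  smul_assoc a r t := mul_assoc (coeffHom σ F a) r t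

/-- The residue map as an `L`-linear map. -/
def mkLinear : SkewPoly σ →ₗ[Twist σ] RF σ F where
  toFun := RF.mk σ F
  map_add' := map_add _
  map_smul' a p := by
    have h : a • p = SkewPolynomial.CRingHom a * p := by
      have := smul_mul_assoc a (1 : SkewPoly σ) p
      rw [one_mul] at this
      rw [← this]
      congr 1
      rw [← SkewPolynomial.monomial_zero_one, SkewPolynomial.smul_monomial, smul_eq_mul, mul_one]
      rfl
    rw [h, map_mul]
    rfl

theorem mk_surjective : Function.Surjective (RF.mk σ F) := Ideal.Quotient.mk_surjective

theorem mk_eq_zero_iff {p : SkewPoly σ} :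
    RF.mk σ F p = 0 ↔ p ∈ (Ideal.span {central σ F} : Ideal (SkewPoly σ)) :=
  Ideal.Quotient.eq_zero_iff_mem

theorem central_eq_sum : central σ F = ∑ i ∈ F.support,
    SkewPolynomial.monomial (orderOf σ * i) (algebraMap K (Twist σ) (F.coeff i)) := by
  rw [central, aeval_eq_sum_range, ← Polynomial.sum_over_range' F (f := fun i c =>
    c • ((SkewPolynomial.X : SkewPoly σ) ^ orderOf σ) ^ i) (by simp) _ (Nat.lt_succ_self _)]
  refine Finset.sum_congr rfl fun i _ => ?_
  simp only
  rw [← pow_mul, ← SkewPolynomial.monomial_one_right_eq_X_pow, SkewPolynomial.smul_monomial,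
    Algebra.algebraMap_eq_smul_one]

theorem coeff_central (hσ : 0 < orderOf σ) (i : ℕ) :
    (central σ F).coeff (orderOf σ * i) = algebraMap K (Twist σ) (F.coeff i) := by
  rw [central_eq_sum, coeff_finsetSum]
  simp only [SkewPolynomial.coeff_monomial, Nat.mul_right_inj hσ.ne']
  rw [Finset.sum_ite_eq']
  split_ifs with h
  · rfl
  · rw [notMem_support_iff.1 h, map_zero]

theorem natDegree_central (hσ : 0 < orderOf σ) (hF : F ≠ 0) :
    natDegree (central σ F) = orderOf σ * F.natDegree := by
  refine sup_support_eq ?_ fun k hk => ?_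
  · rw [coeff_central σ F hσ]
    exact (_root_.map_ne_zero _).2 (leadingCoeff_ne_zero.2 hF)
  · rw [central_eq_sum, coeff_finsetSum]
    refine Finset.sum_eq_zero fun i hi => ?_
    rw [SkewPolynomial.coeff_monomial, if_neg]
    rintro rfl
    exact absurd (Nat.mul_le_mul_left _ (le_natDegree_of_mem_supp i hi)) (not_le.2 hk)

theorem central_ne_zero (hσ : 0 < orderOf σ) (hF : F ≠ 0) : central σ F ≠ 0 := fun h => by
  have := coeff_central σ F hσ F.natDegree
  rw [h] at this
  exact (_root_.map_ne_zero (algebraMap K (Twist σ))).2 (leadingCoeff_ne_zero.2 hF) this.symm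

theorem mk_X_pow : RF.mk σ F SkewPolynomial.X ^ orderOf σ =
    algebraMap (AdjoinRoot F) (RF σ F) (AdjoinRoot.root F) := by
  rw [← AdjoinRoot.mk_X, ← mk_central, central, aeval_X, map_pow]

end


section

variable {R M : Type*} [Field R] [MulSemiringAction (Multiplicative ℕ) R] [AddCommGroup M]
  [Module R M]

/-- A left vector space presented as `R[x; σ]` modulo `g`. -/
def equivOfKerEq (f : SkewPolynomial R →ₗ[R] M) (hf : Function.Surjective f)
    {g : SkewPolynomial R} (hk : ∀ p, f p = 0 ↔ p ∈ Ideal.span {g}) :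
    (SkewPolynomial R ⧸ Ideal.span {g}) ≃ₗ[R] M :=
  (Submodule.Quotient.restrictScalarsEquiv R (Ideal.span {g})).symm.trans <|
    (Submodule.quotEquivOfEq _ _ (by ext p; exact (hk p).symm)).trans
      (f.quotKerEquivOfSurjective hf)

end

variable {K L : Type*} [Field K] [Field L] [Algebra K L] (σ : L ≃ₐ[K] L) (F : K[X])

theorem X_mul_C (a : Twist σ) : (SkewPolynomial.X : SkewPoly σ) * SkewPolynomial.C a =
    SkewPolynomial.C (SkewPolynomial.φ a) * SkewPolynomial.X := by
  rw [← SkewPolynomial.monomial_zero_left, SkewPolynomial.X_mul_monomial,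
    SkewPolynomial.C_mul_X_eq_monomial]

/-- `R_F` is a cyclic algebra when `x` is invertible in it. -/
theorem isCyclicAlgebra_RF [Fact (Irreducible F)] (hσ : 0 < orderOf σ) (ξ : (RF σ F)ˣ)
    (hξ : (ξ : RF σ F) = RF.mk σ F SkewPolynomial.X) :
    IsCyclicAlgebra (E := AdjoinRoot F) (A := RF σ F) σ (coeffHom σ F : L →+* RF σ F) ξ where
  map_algebraMap := coeffHom_algebraMap σ F
  mul_map a := by
    rw [hξ]
    exact ((map_mul (RF.mk σ F) _ _).symm.trans (congrArg (RF.mk σ F) (X_mul_C σ a))).trans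
      (map_mul (RF.mk σ F) _ _)
  exists_sum z := by
    obtain ⟨p, rfl⟩ := mk_surjective σ F z
    rw [hξ]
    induction p using SkewPolynomial.induction with
    | h0 => exact ⟨0, fun _ => Submodule.zero_mem _, by simp⟩
    | ha k a q _ _ ih =>
      obtain ⟨t, ht, hq⟩ := ih
      -- Since x^n acts as y, the monomial a x^k equals y^(k / n) a x^(k % n).
      set u : RF σ F := AdjoinRoot.root F ^ (k / orderOf σ) • coeffHom σ F a with hu
      have humem : u ∈ Submodule.span (AdjoinRoot F)
          (Set.range (coeffHom σ F : L →+* RF σ F)) :=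
        Submodule.smul_mem _ _ (Submodule.subset_span ⟨a, rfl⟩)
      refine ⟨fun i => (if i = k % orderOf σ then u else 0) + t i, fun i => ?_, ?_⟩
      · refine Submodule.add_mem _ ?_ (ht i)
        split_ifs
        exacts [humem, Submodule.zero_mem _]
      simp only [add_mul, Finset.sum_add_distrib, ← hq, map_add, ite_mul, zero_mul,
        Finset.sum_ite_eq', Finset.mem_range, if_pos (Nat.mod_lt k hσ)]
      congr 1
      rw [hu, Algebra.smul_def, Algebra.commutes, map_pow, ← mk_X_pow, ← pow_mul, mul_assoc,
        ← pow_add, Nat.div_add_mod, ← map_pow, ← SkewPolynomial.C_mul_X_pow_eq_monomial, map_mul]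
      rfl

theorem finite_finrank_RF (hσ : 0 < orderOf σ) (hF : F ≠ 0) :
    Module.Finite (Twist σ) (RF σ F) ∧
      Module.finrank (Twist σ) (RF σ F) = orderOf σ * F.natDegree := by
  have h0 := central_ne_zero σ F hσ hF
  let f := equivOfKerEq (mkLinear σ F) (mk_surjective σ F) fun p => mk_eq_zero_iff σ F
  have := finite_quotient_span h0
  exact ⟨Module.Finite.equiv f, by
    rw [← f.finrank_eq, finrank_quotient_span h0]
    exact natDegree_central σ F hσ hF⟩

/-! ### Greatest common right divisors and the left ideal R_F a -/

theorem exists_isGCRD (a b : SkewPoly σ) :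
    ∃ g, Ideal.span {a, b} = Ideal.span {g} ∧ IsGCRD g a b := by
  obtain ⟨g, hg⟩ := exists_eq_span_singleton (Ideal.span {a, b})
  have hmem : ∀ p ∈ Ideal.span {a, b}, ∃ c, p = c * g := fun p hp => by
    obtain ⟨c, hc⟩ := Ideal.mem_span_singleton'.1 (hg ▸ hp)
    exact ⟨c, hc.symm⟩
  refine ⟨g, hg, hmem a (Ideal.subset_span (by simp)), hmem b (Ideal.subset_span (by simp)), ?_⟩
  rintro h ⟨c, hc⟩ ⟨d, hd⟩
  obtain ⟨u, v, huv⟩ := Ideal.mem_span_pair.1 (hg ▸ Ideal.mem_span_singleton_self g :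
    g ∈ Ideal.span {a, b})
  exact ⟨u * c + v * d, by rw [← huv, add_mul, mul_assoc, mul_assoc, ← hc, ← hd]⟩

variable {σ F}

/-- A generator of the left ideal is itself a common right divisor, hence divides any gcrd on the
right; this makes the choice of gcrd immaterial. -/
theorem IsGCRD.span_eq {g a b : SkewPoly σ} (h : IsGCRD g a b) :
    Ideal.span {a, b} = Ideal.span {g} := by
  obtain ⟨g', hg', ha, hb, -⟩ := exists_isGCRD σ a b
  apply le_antisymm
  · obtain ⟨⟨c, hc⟩, ⟨d, hd⟩, -⟩ := h
    refine Ideal.span_le.2 ?_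
    rintro _ (rfl | rfl)
    exacts [Ideal.mem_span_singleton'.2 ⟨c, hc.symm⟩, Ideal.mem_span_singleton'.2 ⟨d, hd.symm⟩]
  · obtain ⟨e, he⟩ := h.2.2 g' ha hb
    rw [hg', Ideal.span_singleton_le_iff_mem]
    exact Ideal.mem_span_singleton'.2 ⟨e, he.symm⟩

variable (σ F) in
/-- `R_F / R_F a` is presented by the greatest common right divisor of `a` and `F(x^n)`. -/
theorem finrank_range_mulRight_twist (hσ : 0 < orderOf σ) (hF : F ≠ 0) {a g : SkewPoly σ}
    (h : IsGCRD g a (central σ F)) :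
    natDegree g + Module.finrank (Twist σ)
      (LinearMap.range (LinearMap.mulRight (Twist σ) (RF.mk σ F a))) =
      orderOf σ * F.natDegree := by
  obtain ⟨_, hfin⟩ := finite_finrank_RF σ F hσ hF
  -- A zero g would force F(x^n) = 0, so the default degree of the zero polynomial never enters.
  have hg : g ≠ 0 := by
    rintro rfl
    obtain ⟨d, hd⟩ := h.2.1
    exact central_ne_zero σ F hσ hF (by rw [hd, mul_zero])
  set N := LinearMap.range (LinearMap.mulRight (Twist σ) (RF.mk σ F a)) with hN
  have hk : ∀ p, (N.mkQ ∘ₗ mkLinear σ F) p = 0 ↔ p ∈ Ideal.span {g} := fun p => by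
    rw [LinearMap.comp_apply, Submodule.mkQ_apply, Submodule.Quotient.mk_eq_zero, ← h.span_eq,
      Ideal.mem_span_pair]
    constructor
    · rintro ⟨r, hr⟩
      obtain ⟨u, rfl⟩ := mk_surjective σ F r
      have hr' : RF.mk σ F (p - u * a) = 0 := by
        rw [map_sub, map_mul]
        exact sub_eq_zero.2 hr.symm
      obtain ⟨v, hv⟩ := Ideal.mem_span_singleton'.1 ((mk_eq_zero_iff σ F).1 hr')
      exact ⟨u, v, by rw [hv, add_sub_cancel]⟩
    · rintro ⟨u, v, rfl⟩
      have h0 : RF.mk σ F (v * central σ F) = 0 :=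
        (mk_eq_zero_iff σ F).2 (Ideal.mem_span_singleton'.2 ⟨v, rfl⟩)
      refine ⟨RF.mk σ F u, ?_⟩
      change RF.mk σ F u * RF.mk σ F a = RF.mk σ F (u * a + v * central σ F)
      rw [map_add, h0, add_zero, map_mul]
  have hq := (equivOfKerEq (N.mkQ ∘ₗ mkLinear σ F)
    (N.mkQ_surjective.comp (mk_surjective σ F)) hk).finrank_eq
  rw [finrank_quotient_span hg] at hq
  rw [← hfin, ← N.finrank_quotient_add_finrank, ← hq]
  rfl

theorem finrank_adjoinRoot (hF : F ≠ 0) : Module.finrank K (AdjoinRoot F) = F.natDegree := by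
  rw [(AdjoinRoot.powerBasis hF).finrank, AdjoinRoot.powerBasis_dim]

variable (σ F) in
-- Both sides are the K-dimension of R_F r, computed through E_F and through L.
theorem finrank_range_mulRight_eq [Fact (Irreducible F)] (r : RF σ F) :
    F.natDegree * Module.finrank (AdjoinRoot F)
      (LinearMap.range (LinearMap.mulRight (AdjoinRoot F) r)) =
    Module.finrank K L * Module.finrank (Twist σ)
      (LinearMap.range (LinearMap.mulRight (Twist σ) r)) := by
  have hF : F ≠ 0 := (Fact.out : Irreducible F).ne_zero
  rw [← finrank_adjoinRoot hF, Module.finrank_mul_finrank]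
  exact (Module.finrank_mul_finrank K (Twist σ)
    (LinearMap.range (LinearMap.mulRight (Twist σ) r))).symm

theorem finrank_range_mulRight_algEquiv {E A B : Type*} [Field E] [Ring A] [Ring B]
    [Algebra E A] [Algebra E B] (e : A ≃ₐ[E] B) (r : A) :
    Module.finrank E (LinearMap.range (LinearMap.mulRight E (e r))) =
      Module.finrank E (LinearMap.range (LinearMap.mulRight E r)) := by
  rw [← LinearEquiv.finrank_map_eq e.toLinearEquiv, ← LinearMap.range_comp]
  have : e.toLinearEquiv.toLinearMap ∘ₗ LinearMap.mulRight E r =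
      LinearMap.mulRight E (e r) ∘ₗ e.toLinearEquiv.toLinearMap :=
    LinearMap.ext fun x => map_mul e x r
  rw [this, LinearMap.range_comp_of_range_eq_top _ e.toLinearEquiv.range]

/-- The power x^n is the class of y in the field E_F, which vanishes only if F = y. -/
theorem isUnit_mk_X [Fact (Irreducible F)] (hmonic : F.Monic) (hX : F ≠ X)
    (hσ : 0 < orderOf σ) : IsUnit (RF.mk σ F SkewPolynomial.X) := by
  rw [← isUnit_pow_iff hσ.ne', mk_X_pow]
  refine IsUnit.map _ (IsUnit.mk0 _ fun h => hX ?_)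
  rw [← AdjoinRoot.mk_X, AdjoinRoot.mk_eq_zero] at h
  exact eq_of_monic_of_associated hmonic monic_X
    ((Fact.out : Irreducible F).associated_of_dvd irreducible_X h)

end SkewRank

end

theorem mainTheorem2 {K L : Type*} [Field K] [Field L] [Algebra K L]
    [FiniteDimensional K L] [IsGalois K L]
    (σ : L ≃ₐ[K] L) (hσ : ∀ τ : L ≃ₐ[K] L, τ ∈ Subgroup.zpowers σ)
    (n : ℕ) (hn : Module.finrank K L = n)
    (F : Polynomial K) (hmonic : F.Monic) (hirr : Irreducible F)
    (s : ℕ) (hs : F.natDegree = s) :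
    -- for finite `K` and `F ≠ y` the algebra `R_F` is a full matrix algebra over `E_F`
    (Finite K → F ≠ Polynomial.X →
      Nonempty (SkewRank.RF σ F ≃ₐ[AdjoinRoot F] Matrix (Fin n) (Fin n) (AdjoinRoot F))) ∧
    -- greatest common right divisors exist
    (∀ a : SkewRank.SkewPoly σ, ∃ g, SkewRank.IsGCRD g a (SkewRank.central σ F)) ∧
    -- the rank formula, for every identification of `R_F` with the matrix algebra
    (∀ (e : SkewRank.RF σ F ≃ₐ[AdjoinRoot F] Matrix (Fin n) (Fin n) (AdjoinRoot F))
      (a g : SkewRank.SkewPoly σ), SkewRank.IsGCRD g a (SkewRank.central σ F) →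
        ((e (SkewRank.RF.mk σ F a)).rank : ℚ) =
          (n : ℚ) - (1 / (s : ℚ)) * (SkewRank.natDegree g : ℚ)) := by
  have : Fact (Irreducible F) := ⟨hirr⟩
  have hF := hirr.ne_zero
  have hpos : 0 < orderOf σ := (isOfFinOrder_of_finite σ).orderOf_pos
  have hord : orderOf σ = n := by
    rw [orderOf_eq_card_of_forall_mem_zpowers hσ, IsGalois.card_aut_eq_finrank, hn]
  have hs0 : 0 < s := hs ▸ hirr.natDegree_pos
  refine ⟨fun _ hX => ?_, fun a => ?_, fun e a g hg => ?_⟩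
  · obtain ⟨ξ, hξ⟩ := SkewRank.isUnit_mk_X (σ := σ) hmonic hX hpos
    have hcyc := SkewRank.isCyclicAlgebra_RF σ F hpos ξ hξ
    obtain ⟨hfin, hdim⟩ := SkewRank.finite_finrank_RF σ F hpos hF
    have : FiniteDimensional K (SkewRank.Twist σ) := inferInstanceAs (FiniteDimensional K L)
    have : Module.Finite K (SkewRank.RF σ F) := Module.Finite.trans (SkewRank.Twist σ) _
    have : Module.Finite K (AdjoinRoot F) := (AdjoinRoot.powerBasis hF).finite
    have : Module.Finite (AdjoinRoot F) (SkewRank.RF σ F) := Module.Finite.of_restrictScalars_finite K _ _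
    have : Finite (AdjoinRoot F) := Module.finite_of_finite K
    -- The K-dimension of R_F is s·dim over E_F and also n·(ns), whence dim = n².
    have h1 := Module.finrank_mul_finrank K (AdjoinRoot F) (SkewRank.RF σ F)
    have h2 := Module.finrank_mul_finrank K (SkewRank.Twist σ) (SkewRank.RF σ F)
    have h3 : Module.finrank K (SkewRank.Twist σ) = n := hn
    rw [SkewRank.finrank_adjoinRoot hF, ← h2, h3, hdim, hord, hs] at h1
    have hdim' : Module.finrank (AdjoinRoot F) (SkewRank.RF σ F) = n ^ 2 :=
      Nat.eq_of_mul_eq_mul_left hs0 (by rw [h1]; ring)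
    have : Nontrivial (SkewRank.RF σ F) := by
      refine Module.nontrivial_of_finrank_pos (R := AdjoinRoot F) ?_
      rw [hdim']
      exact pow_pos (hord ▸ hpos) 2
    have := hcyc.isSimpleRing hσ
    exact SkewRank.exists_algEquiv_matrix_of_finite _ _ (fun z hz => hcyc.exists_algebraMap_eq hσ hz) n hdim'
  · obtain ⟨g, -, hg⟩ := SkewRank.exists_isGCRD σ a (SkewRank.central σ F)
    exact ⟨g, hg⟩
  · have h1 := SkewRank.finrank_range_mulRight_twist σ F hpos hF hg
    have h2 := SkewRank.finrank_range_mulRight_eq σ F (SkewRank.RF.mk σ F a)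
    rw [← SkewRank.finrank_range_mulRight_algEquiv e, SkewRank.finrank_range_mulRight, hs, hn, mul_left_comm] at h2
    have h3 := Nat.eq_of_mul_eq_mul_left (hord ▸ hpos) h2
    rw [← h3, hord, hs] at h1
    have hs' : (s : ℚ) ≠ 0 := Nat.cast_ne_zero.2 hs0.ne'
    have h4 : (SkewRank.natDegree g : ℚ) + s * (e (SkewRank.RF.mk σ F a)).rank = n * s := by exact_mod_cast h1
    field_simp
    linarith
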